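/- **Theorem 4.4.** Let $G$ be a $3$-dimensional (real, smooth) Lie group with Lie algebra $\mathfrak g$, let $g$ be a left-invariant Riemannian metric on $G$, and fix an orientation of $\mathfrak g$. Let $(e_1,e_2,e_3)$ be a positively oriented $g$-orthonormal basis of $\mathfrak g$, also regarded as a left-invariant frame of $TG$. Let $\Sigma=\Lambda^\bullet L'\cong\mathbb C^2$, with $L'=\mathbb C\,y_1$, be the complex spinor module, with basis $(1,y_1)$, on which $e_1,e_2,e_3$ act by Clifford multiplication as $$\begin{pmatrix} i&0\\0&-i\end{pmatrix},\qquad \begin{pmatrix}0&i\\ i&0\end{pmatrix},\qquad \begin{pmatrix}0&-1\\1&0\end{pmatrix}.$$ The spinor bundle of the $G$-invariant spin structure of $(G,g)$ is the trivial bundle $G\times\Sigma$, with Clifford multiplication $X\cdot\phi=\sum_i g(X,e_i)\,e_i\cdot\phi$ and with the spin connection $$\widetilde\nabla_X\psi = d\psi(X)+\tfrac12\sum_{i<j} g(\nabla_X e_i,e_j)\,e_i\cdot e_j\cdot\psi ,$$ where $\nabla$ is the Levi-Civita connection of $g$. A spinor $\psi\colon G\to\Sigma$ is called invariant if $\psi(a^{-1}x)=\psi(x)$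 for all $a,x\in G$. A smooth spinor $\psi$ is called a generalised Killing spinor with endomorphism $A$ if $A$ is a smooth $g$-symmetric field of endomorphisms of $TG$ with $\widetilde\nabla_X\psi=A(X)\cdot\psi$ for every tangent vector $X$. Suppose that $\psi$ is an invariant generalised Killing spinor with endomorphism $A$ and that $\psi$ is not identically zero. Then $A$ commutes with the Ricci endomorphism of $g$, $\mathrm{Ric}(X)=\sum_j R(X,e_j)e_j$, that is, $A_x\circ \mathrm{Ric}_x=\mathrm{Ric}_x\circ A_x$ on $T_xG$ for every $x\in G$. -/

import Mathlib

open Bundle VectorField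
open scoped Manifold ContDiff

noncomputable section

/-! ### The Levi-Civita connection of a Riemannian metric -/

section LeviCivita

variable {E : Type*} [NormedAddCommGroup E] [NormedSpace ℝ E] {H : Type*} [TopologicalSpace H]
  {I : ModelWithCorners ℝ E H} {M : Type*} [TopologicalSpace M] [ChartedSpace H M]
  [IsManifold I ∞ M]
  (g : ContMDiffRiemannianMetric I ∞ E (fun x : M ↦ TangentSpace I x))

/-- The right-hand side of the Koszul formula for `2 g(∇_X Y, Z)`. -/
def koszul (X Y Z : Π x : M, TangentSpace I x) (x : M) : ℝ :=
  mvfderiv I (fun y ↦ g.inner y (Y y) (Z y)) x (X x)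
    + mvfderiv I (fun y ↦ g.inner y (X y) (Z y)) x (Y x)
    - mvfderiv I (fun y ↦ g.inner y (X y) (Y y)) x (Z x)
    + g.inner x (mlieBracket I X Y x) (Z x)
    - g.inner x (mlieBracket I X Z x) (Y x)
    - g.inner x (mlieBracket I Y Z x) (X x)

variable {g}

theorem mdifferentiableAt_metric {X Y : Π x : M, TangentSpace I x} {x : M}
    (hX : MDiffAt (T% X) x) (hY : MDiffAt (T% Y) x) :
    MDiffAt (fun y ↦ g.inner y (X y) (Y y)) x := by
  have : MDifferentiableAt I (I.prod 𝓘(ℝ, ℝ))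
      (fun m ↦ TotalSpace.mk' ℝ (E := Bundle.Trivial M ℝ) m (g.inner m (X m) (Y m))) x := by
    apply MDifferentiableAt.clm_bundle_apply₂ (F₁ := E) (F₂ := E)
    · exact g.contMDiff.mdifferentiableAt (by simp)
    · exact hX
    · exact hY
  simp only [mdifferentiableAt_totalSpace] at this
  exact this.2

theorem tangent_ext_of_metric {x : M} {v w : TangentSpace I x}
    (h : ∀ u, g.inner x v u = g.inner x w u) : v = w := by
  by_contra hne
  have := g.pos x (v - w) (sub_ne_zero.2 hne)
  simp [h] at this

variable [FiniteDimensional ℝ E]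

theorem koszul_tensorial_right {X Y : Π x : M, TangentSpace I x} {x : M}
    (hX : MDiffAt (T% X) x) (hY : MDiffAt (T% Y) x) :
    TensorialAt I E (fun Z ↦ koszul g X Y Z x) x where
  smul {f Z} hf hZ := by
    simp [koszul, mlieBracket_smul_right hf hZ,
      mvfderiv_fun_mul hf (mdifferentiableAt_metric (g := g) hX hZ),
      mvfderiv_fun_mul hf (mdifferentiableAt_metric (g := g) hY hZ)]
    rw [g.symm x (Z x), g.symm x (Z x)]
    ring
  add {Z Z'} hZ hZ' := by
    simp [koszul, mlieBracket_add_right hZ hZ',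
      mvfderiv_fun_add (mdifferentiableAt_metric (g := g) hX hZ)
        (mdifferentiableAt_metric (g := g) hX hZ'),
      mvfderiv_fun_add (mdifferentiableAt_metric (g := g) hY hZ)
        (mdifferentiableAt_metric (g := g) hY hZ')]
    ring

theorem koszul_tensorial_left {Y Z : Π x : M, TangentSpace I x} {x : M}
    (hY : MDiffAt (T% Y) x) (hZ : MDiffAt (T% Z) x) :
    TensorialAt I E (fun X ↦ koszul g X Y Z x) x where
  smul {f X} hf hX := by
    simp [koszul, mlieBracket_smul_left hf hX,
      mvfderiv_fun_mul hf (mdifferentiableAt_metric (g := g) hX hZ),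
      mvfderiv_fun_mul hf (mdifferentiableAt_metric (g := g) hX hY)]
    ring
  add {X X'} hX hX' := by
    simp [koszul, mlieBracket_add_left hX hX',
      mvfderiv_fun_add (mdifferentiableAt_metric (g := g) hX hZ)
        (mdifferentiableAt_metric (g := g) hX' hZ),
      mvfderiv_fun_add (mdifferentiableAt_metric (g := g) hX hY)
        (mdifferentiableAt_metric (g := g) hX' hY)]
    ring

theorem koszul_add {X Y Y' Z : Π x : M, TangentSpace I x} {x : M}
    (hX : MDiffAt (T% X) x) (hY : MDiffAt (T% Y) x) (hY' : MDiffAt (T% Y') x)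
    (hZ : MDiffAt (T% Z) x) :
    koszul g X (Y + Y') Z x = koszul g X Y Z x + koszul g X Y' Z x := by
  simp [koszul, mlieBracket_add_left hY hY', mlieBracket_add_right hY hY',
    mvfderiv_fun_add (mdifferentiableAt_metric (g := g) hY hZ)
      (mdifferentiableAt_metric (g := g) hY' hZ),
    mvfderiv_fun_add (mdifferentiableAt_metric (g := g) hX hY)
      (mdifferentiableAt_metric (g := g) hX hY')]
  ring

theorem koszul_leibniz {X Y Z : Π x : M, TangentSpace I x} {f : M → ℝ} {x : M}
    (hf : MDiffAt f x) (hX : MDiffAt (T% X) x) (hY : MDiffAt (T% Y) x) (hZ : MDiffAt (T% Z) x) :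
    koszul g X (f • Y) Z x =
      f x * koszul g X Y Z x + 2 * (mvfderiv I f x (X x) * g.inner x (Y x) (Z x)) := by
  simp [koszul, mlieBracket_smul_left hf hY, mlieBracket_smul_right hf hY,
    mvfderiv_fun_mul hf (mdifferentiableAt_metric (g := g) hX hY),
    mvfderiv_fun_mul hf (mdifferentiableAt_metric (g := g) hY hZ)]
  rw [g.symm x (Y x) (X x)]
  ring

theorem metric_nondegenerate (g : ContMDiffRiemannianMetric I ∞ E (fun x : M ↦ TangentSpace I x))
    (x : M) : (ContinuousLinearMap.toBilinForm (g.inner x)).Nondegenerate := by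
  have h : ∀ v : TangentSpace I x, (∀ w, g.inner x v w = 0) → v = 0 := fun v hv ↦
    tangent_ext_of_metric (g := g) fun u ↦ by simpa using hv u
  exact ⟨fun v hv ↦ h v hv, fun v hv ↦ h v fun w ↦ (g.symm x v w).trans (hv w)⟩

/-- The isomorphism `T_xM ≃ (T_xM)*`, `v ↦ g_x(v, ·)`, given by the metric. -/
def metricDual (g : ContMDiffRiemannianMetric I ∞ E (fun x : M ↦ TangentSpace I x)) (x : M) :
    TangentSpace I x ≃ₗ[ℝ] Module.Dual ℝ (TangentSpace I x) :=
  haveI : FiniteDimensional ℝ (TangentSpace I x) := inferInstanceAs (FiniteDimensional ℝ E)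
  LinearMap.BilinForm.toDual (ContinuousLinearMap.toBilinForm (g.inner x))
    (metric_nondegenerate g x)

theorem metricDual_symm_apply (g : ContMDiffRiemannianMetric I ∞ E (fun x : M ↦ TangentSpace I x))
    (x : M) (φ : Module.Dual ℝ (TangentSpace I x)) (w : TangentSpace I x) :
    g.inner x ((metricDual g x).symm φ) w = φ w :=
  haveI : FiniteDimensional ℝ (TangentSpace I x) := inferInstanceAs (FiniteDimensional ℝ E)
  LinearMap.BilinForm.apply_toDual_symm_apply
    (B := ContinuousLinearMap.toBilinForm (g.inner x)) (hB := metric_nondegenerate g x) φ w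

/-- The bilinear form `(v, w) ↦ 2 g(∇_v Y, w)` on `T_xM`, for `Y` differentiable at `x`. -/
def koszulForm (g : ContMDiffRiemannianMetric I ∞ E (fun x : M ↦ TangentSpace I x))
    {Y : Π x : M, TangentSpace I x} {x : M} (hY : MDiffAt (T% Y) x) :
    TangentSpace I x →L[ℝ] TangentSpace I x →L[ℝ] ℝ :=
  TensorialAt.mkHom₂ (fun X Z ↦ koszul g X Y Z x) x
    (fun _ hZ ↦ koszul_tensorial_left hY hZ) (fun _ hX ↦ koszul_tensorial_right hX hY)

open Classical in
/-- The map `v ↦ ∇_v Y` on `T_xM` determined by the Koszul formula. (As for `fderiv`, the value is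
`0` by convention if `Y` is not differentiable at `x`.) -/
def leviCivitaFun (g : ContMDiffRiemannianMetric I ∞ E (fun x : M ↦ TangentSpace I x))
    (Y : Π x : M, TangentSpace I x) (x : M) : TangentSpace I x →L[ℝ] TangentSpace I x :=
  haveI : FiniteDimensional ℝ (TangentSpace I x) := inferInstanceAs (FiniteDimensional ℝ E)
  haveI : T2Space (TangentSpace I x) := inferInstanceAs (T2Space E)
  if hY : MDiffAt (T% Y) x then
    LinearMap.toContinuousLinearMap
      ((metricDual g x).symm.toLinearMap ∘ₗ
        ((1 / 2 : ℝ) • ContinuousLinearMap.toBilinForm (koszulForm g hY)))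
  else 0

theorem inner_leviCivitaFun {X Y Z : Π x : M, TangentSpace I x} {x : M}
    (hX : MDiffAt (T% X) x) (hY : MDiffAt (T% Y) x) (hZ : MDiffAt (T% Z) x) :
    g.inner x (leviCivitaFun g Y x (X x)) (Z x) = koszul g X Y Z x / 2 := by
  have h : g.inner x (leviCivitaFun g Y x (X x)) (Z x) =
      (1 / 2) * koszulForm g hY (X x) (Z x) := by
    rw [leviCivitaFun, dif_pos hY]
    exact metricDual_symm_apply g x _ _
  rw [h, koszulForm, TensorialAt.mkHom₂_apply _ _ hX hZ]
  ring

theorem tangent_ext_of_fields {x : M} {v w : TangentSpace I x}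
    (h : ∀ Z : Π x : M, TangentSpace I x, MDiffAt (T% Z) x →
      g.inner x v (Z x) = g.inner x w (Z x)) : v = w :=
  tangent_ext_of_metric (g := g) fun u ↦ by
    simpa using h (FiberBundle.extend E u) (FiberBundle.mdifferentiableAt_extend I E u)

/-- The Levi-Civita connection of a Riemannian metric `g`, built from the Koszul formula.
`leviCivita g Y x v` is `∇_v Y`. -/
def leviCivita (g : ContMDiffRiemannianMetric I ∞ E (fun x : M ↦ TangentSpace I x)) :
    CovariantDerivative I E (fun x : M ↦ TangentSpace I x) where
  toFun := leviCivitaFun g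
  isCovariantDerivativeOnUniv := by
    constructor
    · intro Y Y' x hY hY' _
      ext v
      refine tangent_ext_of_fields (g := g) fun Z hZ ↦ ?_
      have hX := FiberBundle.mdifferentiableAt_extend I E v
      have e : FiberBundle.extend E v x = v := by simp
      rw [← e]
      simp only [_root_.add_apply, map_add]
      rw [inner_leviCivitaFun hX (mdifferentiableAt_add_section hY hY') hZ,
        inner_leviCivitaFun hX hY hZ, inner_leviCivitaFun hX hY' hZ, koszul_add hX hY hY' hZ]
      ring
    · intro Y f x hY hf _
      ext v
      refine tangent_ext_of_fields (g := g) fun Z hZ ↦ ?_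
      have hX := FiberBundle.mdifferentiableAt_extend I E v
      have e : FiberBundle.extend E v x = v := by simp
      rw [← e]
      simp only [_root_.add_apply, map_add, _root_.smul_apply, map_smul,
        ContinuousLinearMap.smulRight_apply, smul_eq_mul]
      rw [inner_leviCivitaFun hX (hf.smul_section hY) hZ, inner_leviCivitaFun hX hY hZ,
        koszul_leibniz hf hX hY hZ]
      ring

theorem inner_leviCivita {X Y Z : Π x : M, TangentSpace I x} {x : M}
    (hX : MDiffAt (T% X) x) (hY : MDiffAt (T% Y) x) (hZ : MDiffAt (T% Z) x) :
    g.inner x (leviCivita g Y x (X x)) (Z x) = koszul g X Y Z x / 2 :=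
  inner_leviCivitaFun hX hY hZ

/-- The Levi-Civita connection is metric. -/
theorem leviCivita_metric {X Y Z : Π x : M, TangentSpace I x} {x : M}
    (hX : MDiffAt (T% X) x) (hY : MDiffAt (T% Y) x) (hZ : MDiffAt (T% Z) x) :
    mvfderiv I (fun y ↦ g.inner y (Y y) (Z y)) x (X x) =
      g.inner x (leviCivita g Y x (X x)) (Z x) + g.inner x (Y x) (leviCivita g Z x (X x)) := by
  rw [g.symm x (Y x), inner_leviCivita hX hY hZ, inner_leviCivita hX hZ hY]
  have h : (fun y ↦ g.inner y (Z y) (Y y)) = fun y ↦ g.inner y (Y y) (Z y) :=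
    funext fun y ↦ g.symm y _ _
  have h1 : mlieBracket I Z Y x = - mlieBracket I Y Z x := mlieBracket_swap_apply
  simp only [koszul, h, h1, map_neg, _root_.neg_apply]
  ring

/-- The Levi-Civita connection is torsion-free: `∇_X Y - ∇_Y X = [X, Y]`. -/
theorem leviCivita_torsion_free {X Y : Π x : M, TangentSpace I x} {x : M}
    (hX : MDiffAt (T% X) x) (hY : MDiffAt (T% Y) x) :
    leviCivita g Y x (X x) - leviCivita g X x (Y x) = mlieBracket I X Y x := by
  refine tangent_ext_of_fields (g := g) fun Z hZ ↦ ?_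
  simp only [map_sub, _root_.sub_apply]
  rw [inner_leviCivita hX hY hZ, inner_leviCivita hY hX hZ]
  have h : (fun y ↦ g.inner y (Y y) (X y)) = fun y ↦ g.inner y (X y) (Y y) :=
    funext fun y ↦ g.symm y _ _
  have h1 : mlieBracket I Y X x = - mlieBracket I X Y x := mlieBracket_swap_apply
  simp only [koszul, h, h1, map_neg, _root_.neg_apply]
  ring

/-- The Riemann curvature tensor of the Levi-Civita connection, on vector fields:
`R(X, Y) Z = ∇_X ∇_Y Z - ∇_Y ∇_X Z - ∇_[X, Y] Z`. -/
def riemannCurvature (g : ContMDiffRiemannianMetric I ∞ E (fun x : M ↦ TangentSpace I x))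
    (X Y Z : Π x : M, TangentSpace I x) (x : M) : TangentSpace I x :=
  leviCivita g (fun y ↦ leviCivita g Z y (Y y)) x (X x)
    - leviCivita g (fun y ↦ leviCivita g Z y (X y)) x (Y x)
    - leviCivita g Z x (mlieBracket I X Y x)

end LeviCivita

/-! ### The spin representation in dimension three -/

/-- The three-dimensional spinor module `Σ = Λ L'`, with `L' = ℂ y₁`, identified with `ℂ²` by means
of its basis `(1, y₁)`. -/
abbrev SpinorModule : Type := Fin 2 → ℂ

/-- Clifford multiplication on `Σ` by the vectors `e₁, e₂, e₃` of a positively oriented orthonormal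
basis, in the basis `(1, y₁)`:
`e₁ · η = i (η_even - η_odd)`, `e₂ · η = i (x₁ ⌟ η + y₁ ∧ η)`, `e₃ · η = y₁ ∧ η - x₁ ⌟ η`. -/
def cliffordGen : Fin 3 → Matrix (Fin 2) (Fin 2) ℂ :=
  ![!![Complex.I, 0; 0, -Complex.I], !![0, Complex.I; Complex.I, 0], !![0, -1; 1, 0]]

/-- The Clifford relations `eᵢ eⱼ + eⱼ eᵢ = - 2 δᵢⱼ`. -/
theorem cliffordGen_mul_add (i j : Fin 3) :
    cliffordGen i * cliffordGen j + cliffordGen j * cliffordGen i =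
      if i = j then (-2 : Matrix (Fin 2) (Fin 2) ℂ) else 0 := by
  have h2 : (-2 : Matrix (Fin 2) (Fin 2) ℂ) = !![-2, 0; 0, -2] := by
    ext a b
    fin_cases a <;> fin_cases b <;> simp [Matrix.ofNat_apply]
  rw [h2]
  ext a b
  fin_cases i <;> fin_cases j <;> fin_cases a <;> fin_cases b <;>
    norm_num [cliffordGen, Matrix.mul_apply, Fin.sum_univ_two]

/-! ### Invariant generalised Killing spinors on three-dimensional Lie groups -/

section LieGroup

variable {E : Type*} [NormedAddCommGroup E] [NormedSpace ℝ E] {H : Type*} [TopologicalSpace H]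
  {I : ModelWithCorners ℝ E H} {G : Type*} [TopologicalSpace G] [ChartedSpace H G] [Group G]
  [IsManifold I ∞ G]

/-- The metric `g` on `G` is left-invariant: all left translations are isometries. -/
def IsLeftInvariantMetric (g : ContMDiffRiemannianMetric I ∞ E (fun x : G ↦ TangentSpace I x)) :
    Prop :=
  ∀ (a x : G) (v w : TangentSpace I x),
    g.inner (a * x) (mfderiv I I (fun y ↦ a * y) x v) (mfderiv I I (fun y ↦ a * y) x w)
      = g.inner x v w

/-- `e` is a `g`-orthonormal basis of the Lie algebra, positively oriented with respect to `o`. -/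
structure IsOrientedOrthonormal
    (g : ContMDiffRiemannianMetric I ∞ E (fun x : G ↦ TangentSpace I x))
    (o : Orientation ℝ (GroupLieAlgebra I G) (Fin 3))
    (e : Module.Basis (Fin 3) ℝ (GroupLieAlgebra I G)) : Prop where
  orthonormal : ∀ i j, g.inner (1 : G) (e i) (e j) = if i = j then 1 else 0
  orientation : e.orientation = o

/-- The left-invariant vector field on `G` with value `e i` at the identity. -/
def leftFrame (e : Module.Basis (Fin 3) ℝ (GroupLieAlgebra I G)) (i : Fin 3) (x : G) :
    TangentSpace I x :=
  mulInvariantVectorField (I := I) (e i) x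

/-- Clifford multiplication by the tangent vector `v ∈ T_xG` on the fibre `Σ` at `x` of the spinor
bundle `G × Σ`, which is trivialised by the orthonormal left-invariant frame given by `e`. -/
def cliffordMul (g : ContMDiffRiemannianMetric I ∞ E (fun x : G ↦ TangentSpace I x))
    (e : Module.Basis (Fin 3) ℝ (GroupLieAlgebra I G)) (x : G) (v : TangentSpace I x) :
    Matrix (Fin 2) (Fin 2) ℂ :=
  ∑ i, (g.inner x v (leftFrame e i x) : ℂ) • cliffordGen i

/-- The spin connection on the spinor bundle `G × Σ`, i.e. the lift of the Levi-Civita connection: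
`∇_v ψ = dψ(v) + (1/2) ∑_{i < j} g(∇_v eᵢ, eⱼ) eᵢ · eⱼ · ψ`. -/
def spinConnection [FiniteDimensional ℝ E]
    (g : ContMDiffRiemannianMetric I ∞ E (fun x : G ↦ TangentSpace I x))
    (e : Module.Basis (Fin 3) ℝ (GroupLieAlgebra I G)) (ψ : G → SpinorModule)
    (x : G) (v : TangentSpace I x) : SpinorModule :=
  mvfderiv I ψ x v +
    (1 / 2 : ℂ) • ∑ i, ∑ j ∈ Finset.Ioi i,
      (g.inner x (leviCivita g (leftFrame e i) x v) (leftFrame e j x) : ℂ) •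
        (cliffordGen i * cliffordGen j).mulVec (ψ x)

/-- A spinor `ψ : G → Σ` is invariant if it is fixed by the action `(a · ψ)(x) = ψ(a⁻¹ x)` of `G`. -/
def IsInvariantSpinor (ψ : G → SpinorModule) : Prop :=
  ∀ a : G, (fun x ↦ ψ (a⁻¹ * x)) = ψ

/-- `ψ` is a generalised Killing spinor with endomorphism (field) `A`: both are smooth, `A` is
`g`-symmetric, and `∇_X ψ = A(X) · ψ` for every tangent vector `X`. -/
structure IsGeneralisedKillingSpinor [FiniteDimensional ℝ E]
    (g : ContMDiffRiemannianMetric I ∞ E (fun x : G ↦ TangentSpace I x))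
    (e : Module.Basis (Fin 3) ℝ (GroupLieAlgebra I G)) (ψ : G → SpinorModule)
    (A : Π x : G, TangentSpace I x →L[ℝ] TangentSpace I x) : Prop where
  smooth_spinor : ContMDiff I 𝓘(ℝ, SpinorModule) ∞ ψ
  smooth_endomorphism : ContMDiff I (I.prod 𝓘(ℝ, E →L[ℝ] E)) ∞ (fun x ↦
    (TotalSpace.mk' (E →L[ℝ] E) x (A x) :
      TotalSpace (E →L[ℝ] E) (fun x : G ↦ TangentSpace I x →L[ℝ] TangentSpace I x)))
  symmetric : ∀ (x : G) (v w : TangentSpace I x), g.inner x (A x v) w = g.inner x v (A x w)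
  killing : ∀ (x : G) (v : TangentSpace I x),
    spinConnection g e ψ x v = (cliffordMul g e x (A x v)).mulVec (ψ x)

/-- The Ricci endomorphism of `g` at `x`: the linear endomorphism of `T_xG` with
`Ric(X) = ∑ⱼ R(X, eⱼ) eⱼ`, computed in the orthonormal left-invariant frame given by `e`. (Since `R`
is a tensor, the result does not depend on the choice of the orthonormal frame.) -/
def ricciEndomorphism [FiniteDimensional ℝ E]
    (g : ContMDiffRiemannianMetric I ∞ E (fun x : G ↦ TangentSpace I x))
    (e : Module.Basis (Fin 3) ℝ (GroupLieAlgebra I G)) (x : G) :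
    TangentSpace I x →L[ℝ] TangentSpace I x :=
  ∑ i, (g.inner x (leftFrame e i x)).smulRight
    (∑ j, riemannCurvature g (leftFrame e i) (leftFrame e j) (leftFrame e j) x)

end LieGroup

end

/-!
An invariant spinor is constant in the left-invariant trivialisation, so the generalised Killing
equation is purely algebraic, and because a nonzero vector acts invertibly on spinors it can be
solved for the connection: `∇_u v = 2 A(u) ⨯ v` on left-invariant fields. The curvature of a
torsion-free connection `∇_u v = S u ⨯ v` is `R(u, v) w = K (u ⨯ v) ⨯ w` with
`K = adj Sᵀ - S (tr S - Sᵀ)`, whence `Ric = Kᵀ - tr K`. For symmetric `S` this is a polynomial in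
`S`, and so it commutes with `A = S / 2`.
-/

noncomputable section

section CrossProduct

open Matrix

variable {R : Type*} [CommRing R]

theorem mulVec_cross_mulVec (S : Matrix (Fin 3) (Fin 3) R) (u v : Fin 3 → R) :
    (S *ᵥ u) ⨯₃ (S *ᵥ v) = Sᵀ.adjugate *ᵥ (u ⨯₃ v) := by
  ext i
  fin_cases i <;>
    simp [cross_apply, adjugate_fin_three, mulVec, dotProduct, Fin.sum_univ_three] <;> ring

theorem mulVec_cross_add_cross_mulVec (S : Matrix (Fin 3) (Fin 3) R) (u v : Fin 3 → R) :
    (S *ᵥ u) ⨯₃ v + u ⨯₃ (S *ᵥ v) = (S.trace • 1 - Sᵀ) *ᵥ (u ⨯₃ v) := by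
  rw [sub_mulVec, smul_mulVec, one_mulVec]
  ext i
  fin_cases i <;>
    simp [cross_apply, mulVec, dotProduct, trace, Fin.sum_univ_three] <;> ring

theorem sum_mulVec_cross_single_cross_single (K : Matrix (Fin 3) (Fin 3) R) (u : Fin 3 → R) :
    ∑ j, (K *ᵥ (u ⨯₃ Pi.single j 1)) ⨯₃ Pi.single j 1 = (Kᵀ - K.trace • 1) *ᵥ u := by
  rw [sub_mulVec, smul_mulVec, one_mulVec]
  ext i
  fin_cases i <;>
    simp [cross_apply, mulVec, dotProduct, trace, Fin.sum_univ_three] <;> ring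

/-- The vector corresponding to a skew-symmetric matrix `M`, with the sign for which row
vectors `c` satisfy `c ᵥ* M = axialVector M ⨯₃ c`. -/
def axialVector (M : Matrix (Fin 3) (Fin 3) R) : Fin 3 → R :=
  ![M 1 2, -M 0 2, M 0 1]

theorem axialVector_cross {M : Matrix (Fin 3) (Fin 3) R} (hM : ∀ i j, M i j = -M j i)
    (hM₀ : ∀ i, M i i = 0) (c : Fin 3 → R) : axialVector M ⨯₃ c = c ᵥ* M := by
  ext i
  fin_cases i <;>
    simp [axialVector, cross_apply, vecMul, dotProduct, Fin.sum_univ_three, hM₀, hM 1 0, hM 2 0,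
      hM 2 1] <;> ring

/-- The matrix `K` of the curvature operator in `R(u, v) w = K (u ⨯₃ v) ⨯₃ w`, for the torsion-free
connection `∇_u v = S u ⨯₃ v` on a Lie algebra. -/
def curvatureMatrix (S : Matrix (Fin 3) (Fin 3) R) : Matrix (Fin 3) (Fin 3) R :=
  Sᵀ.adjugate - S * (S.trace • 1 - Sᵀ)

theorem curvatureMatrix_mulVec_cross_cross (S : Matrix (Fin 3) (Fin 3) R) (u v w : Fin 3 → R) :
    (curvatureMatrix S *ᵥ (u ⨯₃ v)) ⨯₃ w =
      (S *ᵥ u) ⨯₃ ((S *ᵥ v) ⨯₃ w) - (S *ᵥ v) ⨯₃ ((S *ᵥ u) ⨯₃ w)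
        - (S *ᵥ ((S *ᵥ u) ⨯₃ v - (S *ᵥ v) ⨯₃ u)) ⨯₃ w := by
  have bracket : (S *ᵥ u) ⨯₃ v - (S *ᵥ v) ⨯₃ u = (S.trace • 1 - Sᵀ) *ᵥ (u ⨯₃ v) := by
    rw [← mulVec_cross_add_cross_mulVec, ← cross_anticomm u, sub_neg_eq_add]
  rw [bracket, ← cross_cross, mulVec_cross_mulVec, curvatureMatrix, sub_mulVec, ← mulVec_mulVec,
    map_sub, LinearMap.sub_apply]

/-- The matrix of the Ricci endomorphism `u ↦ ∑ⱼ R(u, eⱼ) eⱼ` of the connection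
`∇_u v = S u ⨯₃ v`. -/
def ricciMatrix (S : Matrix (Fin 3) (Fin 3) R) : Matrix (Fin 3) (Fin 3) R :=
  (curvatureMatrix S)ᵀ - (curvatureMatrix S).trace • 1

theorem commute_ricciMatrix {S : Matrix (Fin 3) (Fin 3) R} (hS : S.IsSymm) :
    Commute S (ricciMatrix S) := by
  have adjugate : Commute S S.adjugate := (mul_adjugate S).trans (adjugate_mul S).symm
  have scalar (r : R) : Commute S (r • 1) := (Commute.one_right S).smul_right r
  simp only [ricciMatrix, curvatureMatrix, transpose_sub, transpose_mul, transpose_smul,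
    transpose_one, adjugate_transpose, hS.eq]
  exact (adjugate.sub_right (((scalar _).sub_right (.refl S)).mul_right (.refl S))).sub_right
    (scalar _)

end CrossProduct

section Clifford

open Matrix

/-- Clifford multiplication on the spinor module by the vector with the given coordinates in the
orthonormal frame. -/
def cliffordVec : (Fin 3 → ℝ) →ₗ[ℝ] Matrix (Fin 2) (Fin 2) ℂ :=
  Fintype.linearCombination ℝ cliffordGen

theorem cliffordVec_single (i : Fin 3) : cliffordVec (Pi.single i 1) = cliffordGen i := by
  simp [cliffordVec]

theorem cliffordVec_mul_cliffordVec (u v : Fin 3 → ℝ) :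
    cliffordVec u * cliffordVec v = cliffordVec (u ⨯₃ v) - (u ⬝ᵥ v) • 1 := by
  ext a b
  fin_cases a <;> fin_cases b <;> apply Complex.ext <;>
    simp [cliffordVec, Fintype.linearCombination_apply, cliffordGen, cross_apply,
      Fin.sum_univ_three, Matrix.mul_apply, dotProduct] <;> ring

theorem cliffordVec_mulVec_injective {φ : SpinorModule} (hφ : φ ≠ 0) :
    Function.Injective (cliffordVec · *ᵥ φ) := by
  intro u v huv
  set w := u - v with hw
  have hw₀ : cliffordVec w *ᵥ φ = 0 := by
    rw [hw, map_sub, sub_mulVec]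
    exact sub_eq_zero.2 huv
  have sq : -(w ⬝ᵥ w) • φ = 0 :=
    calc -(w ⬝ᵥ w) • φ = (cliffordVec w * cliffordVec w) *ᵥ φ := by
          simp only [cliffordVec_mul_cliffordVec, cross_self, map_zero, zero_sub, neg_mulVec,
            smul_mulVec, one_mulVec, neg_smul]
      _ = 0 := by rw [← mulVec_mulVec, hw₀, mulVec_zero]
  have dot : w ⬝ᵥ w = 0 := neg_eq_zero.1 ((smul_eq_zero.1 sq).resolve_right hφ)
  exact sub_eq_zero.1 (dotProduct_self_eq_zero.1 dot)

theorem axialVector_eq_sum (M : Matrix (Fin 3) (Fin 3) ℝ) :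
    axialVector M = ∑ i, ∑ j ∈ Finset.Ioi i, M i j • (Pi.single i 1 ⨯₃ Pi.single j 1) := by
  have Ioi_zero : Finset.Ioi (0 : Fin 3) = {1, 2} := by decide
  have Ioi_one : Finset.Ioi (1 : Fin 3) = {2} := by decide
  have Ioi_two : Finset.Ioi (2 : Fin 3) = ∅ := by decide
  ext k
  fin_cases k <;>
    simp [axialVector, Fin.sum_univ_three, cross_apply, Ioi_zero, Ioi_one, Ioi_two]

theorem sum_smul_cliffordGen_mul (M : Matrix (Fin 3) (Fin 3) ℝ) :
    ∑ i, ∑ j ∈ Finset.Ioi i, (M i j : ℂ) • (cliffordGen i * cliffordGen j) =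
      cliffordVec (axialVector M) := by
  simp only [axialVector_eq_sum, map_sum, map_smul]
  refine Finset.sum_congr rfl fun i _ ↦ Finset.sum_congr rfl fun j hij ↦ ?_
  have hne : j ≠ i := (Finset.mem_Ioi.1 hij).ne'
  rw [← cliffordVec_single, ← cliffordVec_single, cliffordVec_mul_cliffordVec, Complex.coe_smul]
  simp [hne]

end Clifford

section OrthonormalBasis

variable {R V ι : Type*} [CommRing R] [AddCommGroup V] [Module R V] [DecidableEq ι]
  {B : LinearMap.BilinForm R V} {b : Module.Basis ι R V}

theorem repr_apply_of_orthonormal (hb : ∀ i j, B (b i) (b j) = if i = j then 1 else 0)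
    (v : V) (i : ι) : b.repr v i = B v (b i) := by
  have : b.coord i = B.flip (b i) := b.ext fun j ↦ by simp [hb, Finsupp.single_apply]
  exact congrArg (fun f ↦ f v) this

theorem isSymm_toMatrix_of_orthonormal [Fintype ι]
    (hb : ∀ i j, B (b i) (b j) = if i = j then 1 else 0) (hB : B.IsSymm) {A : Module.End R V}
    (hA : B.IsSelfAdjoint A) : (LinearMap.toMatrix b b A).IsSymm := by
  ext i j
  rw [Matrix.transpose_apply, LinearMap.toMatrix_apply, LinearMap.toMatrix_apply,
    repr_apply_of_orthonormal hb, repr_apply_of_orthonormal hb, hA, hB.eq]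

end OrthonormalBasis

section LeftInvariant

variable {E : Type*} [NormedAddCommGroup E] [NormedSpace ℝ E] {H : Type*} [TopologicalSpace H]
  {I : ModelWithCorners ℝ E H} {G : Type*} [TopologicalSpace G] [ChartedSpace H G] [Group G]

theorem mulInvariantVectorField_one (u : GroupLieAlgebra I G) :
    mulInvariantVectorField u 1 = u := by
  have hid : (fun x : G ↦ 1 * x) = id := funext one_mul
  have := HasMFDerivAt.mfderiv (hid ▸ hasMFDerivAt_id (I := I) (1 : G))
  exact congrArg (fun L ↦ L u) this

variable [LieGroup I ∞ G]

theorem lieGroup_minSmoothness_three : LieGroup I (minSmoothness ℝ 3) G := by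
  rw [minSmoothness_of_isRCLikeNormedField]
  infer_instance

attribute [local instance] lieGroup_minSmoothness_three

/-- The left trivialisation of `TG` at `x`: the differential at the identity of left translation by
`x`, as a linear isomorphism from the Lie algebra to `T_xG`. -/
def leftTrivialization (x : G) : GroupLieAlgebra I G ≃ₗ[ℝ] TangentSpace I x :=
  LinearEquiv.ofBijective
    { toFun := fun u ↦ mulInvariantVectorField u x
      map_add' := fun u v ↦ congrFun (mulInvariantVectorField_add u v) x
      map_smul' := fun c u ↦ congrFun (mulInvariantVectorField_smul c u) x }
    ((Diffeomorph.smul I I ∞ x : G ≃ₘ^∞⟮I, I⟯ G).mfderivToContinuousLinearEquiv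
      (by simp) 1).bijective

theorem leftTrivialization_apply (x : G) (u : GroupLieAlgebra I G) :
    leftTrivialization x u = mulInvariantVectorField u x := rfl

variable {g : ContMDiffRiemannianMetric I ∞ E (fun x : G ↦ TangentSpace I x)}

theorem inner_mulInvariantVectorField (hg : IsLeftInvariantMetric g)
    (u v : GroupLieAlgebra I G) (x : G) :
    g.inner x (mulInvariantVectorField u x) (mulInvariantVectorField v x)
      = g.inner (1 : G) u v := by
  -- `hg` is about the tangent space at `x * 1`, which is not definitionally the one at `x`.
  suffices ∀ y (_ : y = x), g.inner y (mfderiv I I (fun z ↦ x * z) 1 u)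
      (mfderiv I I (fun z ↦ x * z) 1 v) =
      g.inner x (mulInvariantVectorField u x) (mulInvariantVectorField v x) from
    (this (x * 1) (mul_one x)).symm.trans (hg x 1 u v)
  rintro y rfl
  rfl

/-- The basis of `T_xG` formed by the values at `x` of the left-invariant frame given by `e`. -/
def leftFrameBasis (e : Module.Basis (Fin 3) ℝ (GroupLieAlgebra I G)) (x : G) :
    Module.Basis (Fin 3) ℝ (TangentSpace I x) :=
  e.map (leftTrivialization x)

theorem leftFrameBasis_apply (e : Module.Basis (Fin 3) ℝ (GroupLieAlgebra I G)) (x : G)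
    (i : Fin 3) : leftFrameBasis e x i = leftFrame e i x :=
  e.map_apply (leftTrivialization x) i

theorem leftFrameBasis_repr_mulInvariantVectorField
    (e : Module.Basis (Fin 3) ℝ (GroupLieAlgebra I G)) (x : G) (u : GroupLieAlgebra I G) :
    (leftFrameBasis e x).repr (mulInvariantVectorField u x) = e.repr u := by
  rw [leftFrameBasis, Module.Basis.map_repr, LinearEquiv.trans_apply, ← leftTrivialization_apply,
    LinearEquiv.symm_apply_apply]

theorem inner_leftFrameBasis (hg : IsLeftInvariantMetric g)
    {e : Module.Basis (Fin 3) ℝ (GroupLieAlgebra I G)}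
    (he : ∀ i j, g.inner (1 : G) (e i) (e j) = if i = j then 1 else 0) (x : G) (i j : Fin 3) :
    g.inner x (leftFrameBasis e x i) (leftFrameBasis e x j) = if i = j then 1 else 0 := by
  rw [leftFrameBasis_apply, leftFrameBasis_apply]
  exact (inner_mulInvariantVectorField hg _ _ x).trans (he i j)

theorem leftFrameBasis_repr_apply (hg : IsLeftInvariantMetric g)
    {e : Module.Basis (Fin 3) ℝ (GroupLieAlgebra I G)}
    (he : ∀ i j, g.inner (1 : G) (e i) (e j) = if i = j then 1 else 0) (x : G)
    (v : TangentSpace I x) (i : Fin 3) :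
    (leftFrameBasis e x).repr v i = g.inner x v (leftFrame e i x) := by
  rw [repr_apply_of_orthonormal (B := (g.inner x).toBilinForm) (inner_leftFrameBasis hg he x),
    leftFrameBasis_apply]
  rfl

variable [FiniteDimensional ℝ E]

theorem koszul_mulInvariantVectorField (hg : IsLeftInvariantMetric g)
    (u v w : GroupLieAlgebra I G) (x : G) :
    koszul g (mulInvariantVectorField u) (mulInvariantVectorField v) (mulInvariantVectorField w) x =
      g.inner (1 : G) ⁅u, v⁆ w - g.inner (1 : G) ⁅u, w⁆ v - g.inner (1 : G) ⁅v, w⁆ u := by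
  have := FiniteDimensional.complete ℝ E
  have bracket (a b : GroupLieAlgebra I G) :
      mlieBracket I (mulInvariantVectorField a) (mulInvariantVectorField b) x =
        mulInvariantVectorField ⁅a, b⁆ x :=
    (congrFun (mulInvariantVector_mlieBracket a b) x).symm
  simp only [koszul, bracket, inner_mulInvariantVectorField hg, mvfderiv_const, _root_.zero_apply,
    add_zero, sub_zero, zero_add]

/-- The Levi-Civita connection of a left-invariant metric, as a product `∇_u v` on the Lie algebra:
the value at the identity of the covariant derivative of left-invariant fields. -/
def leftInvariantConnection (g : ContMDiffRiemannianMetric I ∞ E (fun x : G ↦ TangentSpace I x))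
    (u v : GroupLieAlgebra I G) : GroupLieAlgebra I G :=
  leviCivita g (mulInvariantVectorField v) 1 u

theorem inner_leviCivita_mulInvariantVectorField (hg : IsLeftInvariantMetric g)
    (u v w : GroupLieAlgebra I G) (x : G) :
    g.inner x (leviCivita g (mulInvariantVectorField v) x (mulInvariantVectorField u x))
        (mulInvariantVectorField w x) =
      (g.inner (1 : G) ⁅u, v⁆ w - g.inner (1 : G) ⁅u, w⁆ v - g.inner (1 : G) ⁅v, w⁆ u) / 2 := by
  have diff (a : GroupLieAlgebra I G) := mdifferentiableAt_mulInvariantVectorField a (g := x)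
  rw [inner_leviCivita (diff u) (diff v) (diff w), koszul_mulInvariantVectorField hg]

theorem leviCivita_mulInvariantVectorField (hg : IsLeftInvariantMetric g)
    (u v : GroupLieAlgebra I G) (x : G) :
    leviCivita g (mulInvariantVectorField v) x (mulInvariantVectorField u x) =
      mulInvariantVectorField (leftInvariantConnection g u v) x := by
  refine tangent_ext_of_metric (g := g) fun z ↦ ?_
  obtain ⟨w, rfl⟩ := (leftTrivialization x).surjective z
  have at_one := inner_leviCivita_mulInvariantVectorField hg u v w 1
  simp only [mulInvariantVectorField_one] at at_one
  rw [leftTrivialization_apply, inner_leviCivita_mulInvariantVectorField hg,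
    inner_mulInvariantVectorField hg, leftInvariantConnection, at_one]

theorem inner_leftInvariantConnection_left (hg : IsLeftInvariantMetric g)
    (u v w : GroupLieAlgebra I G) :
    g.inner (1 : G) (leftInvariantConnection g u v) w =
      -g.inner (1 : G) v (leftInvariantConnection g u w) := by
  have diff (a : GroupLieAlgebra I G) := mdifferentiableAt_mulInvariantVectorField a (g := (1 : G))
  have metric := leviCivita_metric (g := g) (diff u) (diff v) (diff w)
  simp only [inner_mulInvariantVectorField hg, mvfderiv_const, _root_.zero_apply,
    mulInvariantVectorField_one] at metric
  exact eq_neg_of_add_eq_zero_left metric.symm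

theorem riemannCurvature_mulInvariantVectorField (hg : IsLeftInvariantMetric g)
    (u v w : GroupLieAlgebra I G) (x : G) :
    riemannCurvature g (mulInvariantVectorField u) (mulInvariantVectorField v)
        (mulInvariantVectorField w) x =
      mulInvariantVectorField
        (leftInvariantConnection g u (leftInvariantConnection g v w)
          - leftInvariantConnection g v (leftInvariantConnection g u w)
          - leftInvariantConnection g
              (leftInvariantConnection g u v - leftInvariantConnection g v u) w) x := by
  have diff (a : GroupLieAlgebra I G) := mdifferentiableAt_mulInvariantVectorField a (g := x)
  have sub (a b : GroupLieAlgebra I G) : mulInvariantVectorField a x - mulInvariantVectorField b x =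
      mulInvariantVectorField (a - b) x := (map_sub (leftTrivialization x) a b).symm
  rw [riemannCurvature, ← leviCivita_torsion_free (g := g) (diff u) (diff v)]
  simp only [leviCivita_mulInvariantVectorField hg, sub]

end LeftInvariant

section KillingSpinor

open Matrix

variable {E : Type*} [NormedAddCommGroup E] [NormedSpace ℝ E] {H : Type*} [TopologicalSpace H]
  {I : ModelWithCorners ℝ E H} {G : Type*} [TopologicalSpace G] [ChartedSpace H G] [Group G]
  [LieGroup I ∞ G] {g : ContMDiffRiemannianMetric I ∞ E (fun x : G ↦ TangentSpace I x)}
  {e : Module.Basis (Fin 3) ℝ (GroupLieAlgebra I G)} {x : G}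

theorem cliffordMul_eq_cliffordVec (hg : IsLeftInvariantMetric g)
    (he : ∀ i j, g.inner (1 : G) (e i) (e j) = if i = j then 1 else 0) (v : TangentSpace I x) :
    cliffordMul g e x v = cliffordVec ((leftFrameBasis e x).repr v) := by
  simp only [cliffordMul, cliffordVec, Fintype.linearCombination_apply, Complex.coe_smul,
    leftFrameBasis_repr_apply hg he]

variable [FiniteDimensional ℝ E]

/-- The matrix with entries `g(∇_v eᵢ, eⱼ)` of the Levi-Civita connection in the left-invariant
frame given by `e`. -/
def connectionMatrix (g : ContMDiffRiemannianMetric I ∞ E (fun x : G ↦ TangentSpace I x))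
    (e : Module.Basis (Fin 3) ℝ (GroupLieAlgebra I G)) (x : G) (v : TangentSpace I x) :
    Matrix (Fin 3) (Fin 3) ℝ :=
  of fun i j ↦ g.inner x (leviCivita g (leftFrame e i) x v) (leftFrame e j x)

theorem spinConnection_eq_cliffordVec (ψ : G → SpinorModule) (v : TangentSpace I x) :
    spinConnection g e ψ x v = mvfderiv I ψ x v +
      (1 / 2 : ℝ) • cliffordVec (axialVector (connectionMatrix g e x v)) *ᵥ ψ x := by
  simp only [spinConnection, ← sum_smul_cliffordGen_mul, sum_mulVec, smul_mulVec, connectionMatrix,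
    of_apply]
  norm_num [← Complex.coe_smul]

theorem axialVector_connectionMatrix_of_killing (hg : IsLeftInvariantMetric g)
    (he : ∀ i j, g.inner (1 : G) (e i) (e j) = if i = j then 1 else 0)
    {ψ : G → SpinorModule} (hψ : ψ x ≠ 0) (hdψ : HasMFDerivAt I 𝓘(ℝ, SpinorModule) ψ x 0)
    {v w : TangentSpace I x}
    (hvw : spinConnection g e ψ x v = cliffordMul g e x w *ᵥ ψ x) :
    axialVector (connectionMatrix g e x v) = (2 : ℝ) • (leftFrameBasis e x).repr w := by
  have dψ : mvfderiv I ψ x v = 0 := by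
    rw [mvfderiv, hdψ.mfderiv]
    simp
  rw [spinConnection_eq_cliffordVec, dψ, zero_add, cliffordMul_eq_cliffordVec hg he] at hvw
  apply cliffordVec_mulVec_injective hψ
  simp only [map_smul, smul_mulVec]
  rw [← hvw, smul_smul]
  norm_num

theorem connectionMatrix_mulInvariantVectorField (hg : IsLeftInvariantMetric g)
    (u : GroupLieAlgebra I G) (i j : Fin 3) :
    connectionMatrix g e x (mulInvariantVectorField u x) i j =
      g.inner (1 : G) (leftInvariantConnection g u (e i)) (e j) :=
  (congrArg (g.inner x · (leftFrame e j x)) (leviCivita_mulInvariantVectorField hg u (e i) x)).trans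
    (inner_mulInvariantVectorField hg _ _ x)

theorem connectionMatrix_skew (hg : IsLeftInvariantMetric g) (v : TangentSpace I x)
    (i j : Fin 3) : connectionMatrix g e x v i j = -connectionMatrix g e x v j i := by
  obtain ⟨u, rfl⟩ := (leftTrivialization x).surjective v
  rw [leftTrivialization_apply, connectionMatrix_mulInvariantVectorField hg,
    connectionMatrix_mulInvariantVectorField hg, inner_leftInvariantConnection_left hg, g.symm]

theorem repr_leftInvariantConnection (hg : IsLeftInvariantMetric g)
    (he : ∀ i j, g.inner (1 : G) (e i) (e j) = if i = j then 1 else 0)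
    (u v : GroupLieAlgebra I G) (x : G) :
    ⇑(e.repr (leftInvariantConnection g u v)) =
      axialVector (connectionMatrix g e x (mulInvariantVectorField u x)) ⨯₃ e.repr v := by
  rw [axialVector_cross (connectionMatrix_skew hg _)
    fun i ↦ self_eq_neg.1 (connectionMatrix_skew hg _ i i)]
  ext j
  calc e.repr (leftInvariantConnection g u v) j
      = g.inner (1 : G) (leftInvariantConnection g u v) (e j) :=
        repr_apply_of_orthonormal (B := (g.inner (1 : G)).toBilinForm) he _ j
    _ = -g.inner (1 : G) (∑ i, e.repr v i • e i) (leftInvariantConnection g u (e j)) := by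
        rw [inner_leftInvariantConnection_left hg, e.sum_repr]
    _ = ∑ i, e.repr v i * -g.inner (1 : G) (e i) (leftInvariantConnection g u (e j)) := by
        simp only [map_sum, map_smul, _root_.sum_apply, _root_.smul_apply, smul_eq_mul, mul_neg,
          Finset.sum_neg_distrib]
    _ = _ := by
        simp only [vecMul, dotProduct, connectionMatrix_mulInvariantVectorField hg,
          inner_leftInvariantConnection_left hg]

theorem repr_riemannCurvature (hg : IsLeftInvariantMetric g) {S : Matrix (Fin 3) (Fin 3) ℝ}
    (hS : ∀ u v, ⇑(e.repr (leftInvariantConnection g u v)) = (S *ᵥ e.repr u) ⨯₃ e.repr v)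
    (u v w : GroupLieAlgebra I G) (x : G) :
    ⇑((leftFrameBasis e x).repr (riemannCurvature g (mulInvariantVectorField u)
        (mulInvariantVectorField v) (mulInvariantVectorField w) x)) =
      (curvatureMatrix S *ᵥ (e.repr u ⨯₃ e.repr v)) ⨯₃ e.repr w := by
  rw [riemannCurvature_mulInvariantVectorField hg, leftFrameBasis_repr_mulInvariantVectorField,
    curvatureMatrix_mulVec_cross_cross]
  simp only [map_sub, Finsupp.coe_sub, hS]

theorem ricciEndomorphism_leftFrame (hg : IsLeftInvariantMetric g)
    (he : ∀ i j, g.inner (1 : G) (e i) (e j) = if i = j then 1 else 0) (x : G) (i : Fin 3) :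
    ricciEndomorphism g e x (leftFrame e i x) =
      ∑ j, riemannCurvature g (leftFrame e i) (leftFrame e j) (leftFrame e j) x := by
  have orthonormal (k : Fin 3) :
      g.inner x (leftFrame e k x) (leftFrame e i x) = if k = i then 1 else 0 :=
    (inner_mulInvariantVectorField hg _ _ x).trans (he k i)
  simp [ricciEndomorphism, orthonormal]

theorem toMatrix_ricciEndomorphism (hg : IsLeftInvariantMetric g)
    (he : ∀ i j, g.inner (1 : G) (e i) (e j) = if i = j then 1 else 0)
    {S : Matrix (Fin 3) (Fin 3) ℝ}
    (hS : ∀ u v, ⇑(e.repr (leftInvariantConnection g u v)) = (S *ᵥ e.repr u) ⨯₃ e.repr v)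
    (x : G) :
    LinearMap.toMatrix (leftFrameBasis e x) (leftFrameBasis e x) (ricciEndomorphism g e x) =
      ricciMatrix S := by
  have curvature (i j : Fin 3) : ⇑((leftFrameBasis e x).repr
        (riemannCurvature g (leftFrame e i) (leftFrame e j) (leftFrame e j) x)) =
      (curvatureMatrix S *ᵥ (Pi.single i 1 ⨯₃ Pi.single j 1)) ⨯₃ Pi.single j 1 := by
    have := repr_riemannCurvature hg hS (e i) (e j) (e j) x
    simp only [e.repr_self, Finsupp.single_eq_pi_single] at this
    exact this
  ext k i
  rw [LinearMap.toMatrix_apply, leftFrameBasis_apply, ContinuousLinearMap.coe_coe,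
    ricciEndomorphism_leftFrame hg he, map_sum, Finsupp.coe_finsetSum]
  simp only [curvature, sum_mulVec_cross_single_cross_single, mulVec_single_one]
  rfl

end KillingSpinor

theorem IsInvariantSpinor.exists_eq_const {G : Type*} [Group G] {ψ : G → SpinorModule}
    (hψ : IsInvariantSpinor ψ) : ∃ φ, ψ = fun _ ↦ φ :=
  ⟨ψ 1, funext fun x ↦ by simpa using (congrFun (hψ x) x).symm⟩

open Matrix in
theorem theorem4p4_general
    {E : Type*} [NormedAddCommGroup E] [NormedSpace ℝ E] [FiniteDimensional ℝ E]
    {H : Type*} [TopologicalSpace H] {I : ModelWithCorners ℝ E H}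
    {G : Type*} [TopologicalSpace G] [ChartedSpace H G] [Group G] [LieGroup I ∞ G]
    {g : ContMDiffRiemannianMetric I ∞ E (fun x : G ↦ TangentSpace I x)}
    (hg : IsLeftInvariantMetric g)
    {e : Module.Basis (Fin 3) ℝ (GroupLieAlgebra I G)}
    (he : ∀ i j, g.inner (1 : G) (e i) (e j) = if i = j then 1 else 0)
    {x : G} {ψ : G → SpinorModule} (hψ : ψ x ≠ 0) (hdψ : HasMFDerivAt I 𝓘(ℝ, SpinorModule) ψ x 0)
    {A : TangentSpace I x →L[ℝ] TangentSpace I x}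
    (hA : ∀ v w, g.inner x (A v) w = g.inner x v (A w))
    (killing : ∀ v, spinConnection g e ψ x v = cliffordMul g e x (A v) *ᵥ ψ x) :
    A.comp (ricciEndomorphism g e x) = (ricciEndomorphism g e x).comp A := by
  set b := leftFrameBasis e x
  set S := LinearMap.toMatrix b b (A : TangentSpace I x →ₗ[ℝ] TangentSpace I x) with hS
  have symm : S.IsSymm := isSymm_toMatrix_of_orthonormal (B := (g.inner x).toBilinForm)
    (inner_leftFrameBasis hg he x) ⟨fun v w ↦ g.symm x v w⟩ hA
  have connection (u v : GroupLieAlgebra I G) :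
      ⇑(e.repr (leftInvariantConnection g u v)) = (((2 : ℝ) • S) *ᵥ e.repr u) ⨯₃ e.repr v := by
    rw [repr_leftInvariantConnection hg he u v x,
      axialVector_connectionMatrix_of_killing hg he hψ hdψ (killing _), smul_mulVec,
      ← leftFrameBasis_repr_mulInvariantVectorField e x u, hS, LinearMap.toMatrix_mulVec_repr]
    rfl
  have commute : Commute S (ricciMatrix ((2 : ℝ) • S)) :=
    (Commute.smul_left_iff₀ two_ne_zero).1 (commute_ricciMatrix (symm.smul 2))
  apply ContinuousLinearMap.coe_injective
  apply (LinearMap.toMatrix b b).injective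
  rw [ContinuousLinearMap.toLinearMap_comp, ContinuousLinearMap.toLinearMap_comp,
    LinearMap.toMatrix_comp b b b, LinearMap.toMatrix_comp b b b,
    toMatrix_ricciEndomorphism hg he connection]
  exact commute

end

theorem theorem4p4
    {E : Type*} [NormedAddCommGroup E] [NormedSpace ℝ E] [FiniteDimensional ℝ E]
    (hdim : Module.finrank ℝ E = 3)
    {G : Type*} [TopologicalSpace G] [ChartedSpace E G] [Group G] [LieGroup 𝓘(ℝ, E) ∞ G]
    (o : Orientation ℝ (GroupLieAlgebra 𝓘(ℝ, E) G) (Fin 3))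
    (g : ContMDiffRiemannianMetric 𝓘(ℝ, E) ∞ E (fun x : G ↦ TangentSpace 𝓘(ℝ, E) x))
    (hg : IsLeftInvariantMetric g)
    (e : Module.Basis (Fin 3) ℝ (GroupLieAlgebra 𝓘(ℝ, E) G))
    (he : IsOrientedOrthonormal g o e)
    (ψ : G → SpinorModule) (hψ : ψ ≠ 0) (hinv : IsInvariantSpinor ψ)
    (A : Π x : G, TangentSpace 𝓘(ℝ, E) x →L[ℝ] TangentSpace 𝓘(ℝ, E) x)
    (hA : IsGeneralisedKillingSpinor g e ψ A) (x : G) :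
    (A x).comp (ricciEndomorphism g e x) = (ricciEndomorphism g e x).comp (A x) := by
  obtain ⟨φ, rfl⟩ := hinv.exists_eq_const
  have hφ : φ ≠ 0 := fun h ↦ hψ (funext fun _ ↦ h)
  exact theorem4p4_general hg he.orthonormal hφ (hasMFDerivAt_const φ x) (hA.symmetric x)
    (hA.killing x)
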